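/- Let $Q$ be a well-founded poset (every non-empty subset of $Q$ has a minimal element), let $I_{<\omega}(Q)$ be the set of finitely generated initial segments $\downarrow A=\{x\in Q: x\le a \text{ for some } a\in A\}$ of $Q$, where $A$ ranges over the finite (possibly empty) subsets of $Q$, and let $\mathcal F\subseteq I_{<\omega}(Q)$. Let $\mathcal F^{<\omega}$ (resp. $\mathcal F^{\cup}$) be the collection of all unions of finitely (resp. arbitrarily) many members of $\mathcal F$, the empty union $\emptyset$ included. Order $\mathcal F$, $\mathcal F^{<\omega}$ and $\mathcal F^{\cup}$ by inclusion. For a poset $P$ let $J(P)$ be the set of ideals of $P$, that is, of the non-empty directed (every two elements have an upper bound in the set) initial segments of $P$, with the topology induced by the product topology on the power set $\mathfrak P(P)=\{0,1\}^P$, where $\{0,1\}$ is discrete. Then the following properties are equivalent: 1. $\mathcal F$ has no infinite antichain; 2. $\mathcal F^{<\omega}$ is well-quasi-ordered, that is, it is well-founded and has no infinite antichain; 3. $J(\mathcal F^{<\omega})$ is topologically scattered, that is, every non-empty closed subset $C$ of it contains a point that is isolated in $C$; 4. $\mathcal F^{\cup}$ is order-scattered, that is, it contains no subset order-isomorphic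 to the chain $\mathbb Q$ of rational numbers; 5. the power set $\mathfrak P(\omega)$, ordered by inclusion, does not embed as a poset in $\mathcal F^{\cup}$; 6. the set $[\omega]^{<\omega}$ of finite subsets of $\omega$, ordered by inclusion, does not embed as a poset in $\mathcal F^{<\omega}$; 7. $\mathcal F^{\cup}$ is well-founded. -/

import Mathlib

/-- The finitely generated initial segments of a poset `Q`, i.e. the sets `↓A` with `A` a finite
subset of `Q`. The empty set is one of them. -/
def finGenInitialSegments (Q : Type*) [PartialOrder Q] : Set (Set Q) :=
  {I | ∃ A : Set Q, A.Finite ∧ I = (lowerClosure A : Set Q)}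

/-- The collection of all unions of finitely many members of `𝓕`, including the empty union.
Coerced to a type, it is ordered by inclusion. -/
def finiteUnions {E : Type*} (𝓕 : Set (Set E)) : Set (Set E) :=
  {X | ∃ S : Set (Set E), S ⊆ 𝓕 ∧ S.Finite ∧ X = ⋃₀ S}

/-- The collection of all unions of arbitrarily many members of `𝓕`, including the empty union.
Coerced to a type, it is ordered by inclusion. -/
def arbitraryUnions {E : Type*} (𝓕 : Set (Set E)) : Set (Set E) :=
  {X | ∃ S : Set (Set E), S ⊆ 𝓕 ∧ X = ⋃₀ S}

/-- A poset is (order-)scattered if it contains no copy of the chain of rational numbers. -/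
def OrderScattered (P : Type*) [PartialOrder P] : Prop :=
  IsEmpty (ℚ ↪o P)

/-- A topological space is scattered if every non-empty closed subset `C` contains a point which is
isolated in `C`. -/
def TopologicallyScattered (T : Type*) [TopologicalSpace T] : Prop :=
  ∀ C : Set T, IsClosed C → C.Nonempty → ∃ x ∈ C, ∃ U : Set T, IsOpen U ∧ U ∩ C = {x}

open Classical in
/-- The topology on the set of ideals (non-empty directed initial segments) of `P` as a subspace of
the power set of `P`: the power set is the product space `P → Bool` with `Bool` discrete, where a
subset of `P` is identified with its characteristic function. -/
noncomputable instance idealTopologicalSpace (P : Type*) [PartialOrder P] :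
    TopologicalSpace (Order.Ideal P) :=
  TopologicalSpace.induced (fun (J : Order.Ideal P) (x : P) => decide (x ∈ J))
    (inferInstance : TopologicalSpace (P → Bool))

/-!
The finitely generated initial segments of a well-founded poset are themselves well-founded under
inclusion (`wellFoundedLT_finGenInitialSegments`). So if `𝓕` has no infinite antichain, then it is
well-quasi-ordered, and so are its finite unions by Higman's lemma
(`wellQuasiOrderedLE_finiteUnions`). Over a well-quasi-ordered family two kinds of sets are
well-founded (`wellFoundedLT_of_separating`): the arbitrary unions, which therefore contain no copy
of `ℚ`, and the ideals of the finite unions. A minimal ideal in a set of ideals is isolated in it,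
because its complement has finitely many minimal elements (`topologicallyScattered_ideal`).

In the other direction everything passes through the finite subsets of `ℕ`. The chain `ℚ` embeds in
the power set of `ℕ`, which embeds in the arbitrary unions as soon as the finite subsets of `ℕ`
embed in the finite unions, because finitely generated initial segments are compact
(`nonempty_set_embedding_of_finset_embedding`); and the ideals attached to the infinite subsets of
`ℕ` would form a set without isolated point
(`isEmpty_finset_embedding_of_topologicallyScattered`).

The heart of the matter is that an infinite antichain `A 0, A 1, …` in `𝓕` produces an embedding of
the finite subsets of `ℕ` in the finite unions. It suffices to find a subsequence no member of which
is covered by the others (`exists_independent_subsequence`). Let `L` be the limit of the `A n` along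
a nonprincipal ultrafilter. No `A n` is contained in `L`, and a point of `A n` outside `L` avoids
almost all `A m`. If some finitely generated `X` contains almost all `A m \ L`, take a minimal one:
its maximal elements lie in almost no `A m \ L`, so finitely many suitable `A m` never cover almost
all of the `A n \ L`. If there is no such `X`, this holds for any finitely many `A m`. Hence indices
and witnesses outside `L` can be chosen one after the other.
-/

open Set Filter

/-! ### Finitely generated initial segments -/

section FinGen

variable {Q : Type*} [PartialOrder Q]

theorem mem_finGenInitialSegments_of_finite {T : Set Q} (hT : T.Finite) :
    (lowerClosure T : Set Q) ∈ finGenInitialSegments Q :=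
  ⟨T, hT, rfl⟩

/-- The maximal elements of a finite generating set still generate. -/
theorem exists_antichain_generators {X : Set Q} (hX : X ∈ finGenInitialSegments Q) :
    ∃ T : Finset Q, X = lowerClosure (T : Set Q) ∧ IsAntichain (· ≤ ·) (T : Set Q) := by
  obtain ⟨A, hA, rfl⟩ := hX
  have hfin : {a | Maximal (· ∈ A) a}.Finite := hA.subset fun a ha => ha.prop
  refine ⟨hfin.toFinset, ?_, ?_⟩
  · ext x
    simp only [Finite.coe_toFinset, SetLike.mem_coe, mem_lowerClosure, mem_ofPred_eq]
    constructor
    · rintro ⟨a, ha, hxa⟩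
      obtain ⟨b, hab, hb⟩ := hA.exists_le_maximal ha
      exact ⟨b, hb, hxa.trans hab⟩
    · rintro ⟨a, ha, hxa⟩
      exact ⟨a, ha.prop, hxa⟩
  · intro a ha b hb hab hle
    simp only [Finite.coe_toFinset, mem_ofPred_eq] at ha hb
    exact hab (le_antisymm hle (ha.le_of_ge hb.prop hle))

/-- Finitely generated initial segments of a well-founded poset are well-founded under inclusion:
passing to a proper sub-segment decreases the set of maximal elements in the Dershowitz–Manna
ordering. -/
theorem wellFoundedLT_finGenInitialSegments [WellFoundedLT Q] :
    WellFoundedLT (finGenInitialSegments Q) := by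
  classical
  choose g hg hanti using fun X : finGenInitialSegments Q => exists_antichain_generators X.2
  refine ⟨Subrelation.wf ?_ (InvImage.wf (fun X => (g X).val)
    (Multiset.wellFounded_isDershowitzMannaLT (α := Q)))⟩
  intro X Y hXY
  have hle : X.1 ⊆ Y.1 := hXY.le
  have hmem : ∀ Z : finGenInitialSegments Q, ∀ x, x ∈ Z.1 ↔ ∃ t ∈ g Z, x ≤ t := fun Z x => by
    have h1 : x ∈ Z.1 ↔ x ∈ (lowerClosure (g Z : Set Q) : Set Q) := by rw [← hg Z]
    simpa using h1
  refine ⟨(g X).val ∩ (g Y).val, (g X).val - (g Y).val, (g Y).val - (g X).val, ?_, ?_, ?_, ?_⟩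
  · intro h0
    apply hXY.not_ge
    intro x hx
    obtain ⟨t, ht, hxt⟩ := (hmem Y x).1 hx
    refine (hmem X x).2 ⟨t, ?_, hxt⟩
    by_contra htX
    have : t ∈ (g Y).val - (g X).val := (Multiset.mem_sub_of_nodup (g Y).nodup).2 ⟨ht, htX⟩
    simp [h0] at this
  · rw [add_comm, Multiset.sub_add_inter]
  · rw [add_comm, Multiset.inter_comm, Multiset.sub_add_inter]
  · intro y hy
    obtain ⟨hyX, hyY⟩ := (Multiset.mem_sub_of_nodup (g X).nodup).1 hy
    obtain ⟨t, ht, hyt⟩ := (hmem Y y).1 (hle ((hmem X y).2 ⟨y, hyX, le_rfl⟩))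
    have hne : y ≠ t := by rintro rfl; exact hyY ht
    refine ⟨t, (Multiset.mem_sub_of_nodup (g Y).nodup).2 ⟨ht, fun htX => ?_⟩,
      lt_of_le_of_ne hyt hne⟩
    exact hanti X (Finset.mem_coe.2 hyX) (Finset.mem_coe.2 htX) hne hyt

theorem isLowerSet_of_mem_finGenInitialSegments {X : Set Q} (hX : X ∈ finGenInitialSegments Q) :
    IsLowerSet X := by
  obtain ⟨A, -, rfl⟩ := hX
  exact (lowerClosure A).lower

theorem finiteUnions_subset_finGenInitialSegments {𝓕 : Set (Set Q)}
    (h𝓕 : 𝓕 ⊆ finGenInitialSegments Q) : finiteUnions 𝓕 ⊆ finGenInitialSegments Q := by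
  rintro _ ⟨S, hS, hfin, rfl⟩
  choose! T hT hX using fun X (hX : X ∈ S) => h𝓕 (hS hX)
  refine ⟨⋃ X ∈ S, T X, hfin.biUnion hT, ?_⟩
  ext x
  simp only [mem_sUnion, SetLike.mem_coe, mem_lowerClosure, mem_iUnion]
  constructor
  · rintro ⟨X, hXS, hx⟩
    rw [hX X hXS] at hx
    obtain ⟨t, ht, hxt⟩ := hx
    exact ⟨t, ⟨X, hXS, ht⟩, hxt⟩
  · rintro ⟨t, ⟨X, hXS, ht⟩, hxt⟩
    refine ⟨X, hXS, ?_⟩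
    rw [hX X hXS]
    exact ⟨t, ht, hxt⟩

/-- Finitely generated initial segments are compact elements of the lattice of initial segments. -/
theorem exists_subset_of_subset_iUnion_of_directed {ι : Type*} [Nonempty ι] {X : Set Q}
    (hX : X ∈ finGenInitialSegments Q) {F : ι → Set Q} (hF : ∀ i, IsLowerSet (F i))
    (hdir : Directed (· ⊆ ·) F) (h : X ⊆ ⋃ i, F i) : ∃ i, X ⊆ F i := by
  obtain ⟨A, hA, rfl⟩ := hX
  obtain ⟨i, hi⟩ := hdir.exists_mem_subset_of_finset_subset_biUnion (s := hA.toFinset)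
    (by simpa using (subset_lowerClosure.trans h))
  exact ⟨i, lowerClosure_min (by simpa using hi) (hF i)⟩

end FinGen

/-! ### Independent subsequences -/

section Independent

variable {Q : Type*} [PartialOrder Q] [WellFoundedLT Q]

/-- A sequence of pairwise incomparable finitely generated initial segments of a well-founded poset
has a subsequence of which no member is covered by the union of the others. The limit of the
sequence along an ultrafilter contains no member, and the witnesses are picked outside this
limit. -/
theorem exists_independent_subsequence {A : ℕ → Set Q} (hA : ∀ n, A n ∈ finGenInitialSegments Q)
    (hanti : ∀ m n, m ≠ n → ¬ A m ⊆ A n) :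
    ∃ (φ : ℕ → ℕ) (z : ℕ → Q), ∀ m n, z m ∈ A (φ n) ↔ m = n := by
  choose T hT hAT using hA
  have hmem : ∀ n x, x ∈ A n ↔ ∃ t ∈ T n, x ≤ t := fun n x => by rw [hAT]; rfl
  have hlow : ∀ n {x y}, x ≤ y → y ∈ A n → x ∈ A n := fun n x y hxy hy => by
    rw [hmem] at hy ⊢
    obtain ⟨t, ht, hyt⟩ := hy
    exact ⟨t, ht, hxy.trans hyt⟩
  let U : Ultrafilter ℕ := hyperfilter ℕ
  let L : Set Q := {x | ∀ᶠ n in U, x ∈ A n}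
  have hLlow : ∀ {x y}, x ≤ y → y ∈ L → x ∈ L := fun hxy hy => hy.mono fun n => hlow n hxy
  have hL : ∀ x, x ∉ L → ∀ᶠ n in U, x ∉ A n := fun x hx => Ultrafilter.eventually_not.2 hx
  -- otherwise the finitely many generators of `A n` would lie in a common `A m` with `m ≠ n`
  have hne : ∀ n, ∃ x ∈ A n, x ∉ L := by
    intro n
    by_contra! h
    have h1 : ∀ᶠ m in U, ∀ t ∈ T n, t ∈ A m :=
      (eventually_all_finite (hT n)).2 fun t ht => h t ((hmem n t).2 ⟨t, ht, le_rfl⟩)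
    have h2 : ∀ᶠ m in U, m ≠ n := by
      rw [Ultrafilter.eventually_not]
      exact (finite_singleton n).notMem_hyperfilter
    obtain ⟨m, hm, hmn⟩ := (h1.and h2).exists
    refine hanti n m hmn.symm fun x hx => ?_
    obtain ⟨t, ht, hxt⟩ := (hmem n x).1 hx
    exact hlow m hxt (hm t ht)
  -- the part of a finite union of members outside `L` lies in the segment generated by `D K`
  let D : Finset ℕ → Set Q := fun K => ⋃ k ∈ K, T k \ L
  have hD : ∀ K, (D K).Finite := fun K => K.finite_toSet.biUnion fun k _ => (hT k).sdiff
  have hDmem : ∀ K x, x ∉ L → (∃ k ∈ K, x ∈ A k) → x ∈ lowerClosure (D K) := by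
    rintro K x hx ⟨k, hk, hxk⟩
    obtain ⟨t, ht, hxt⟩ := (hmem k x).1 hxk
    refine ⟨t, ?_, hxt⟩
    simp only [D, mem_iUnion]
    exact ⟨k, hk, ht, fun h => hx (hLlow hxt h)⟩
  obtain ⟨S, hSU, hS⟩ : ∃ S ∈ U, ∀ K : Finset ℕ, (∀ k ∈ K, k ∈ S) →
      ¬ ∀ᶠ m in U, A m \ L ⊆ lowerClosure (D K) := by
    by_cases hX : ∃ X : finGenInitialSegments Q, ∀ᶠ m in U, A m \ L ⊆ X
    · -- for a minimal such `X`, keep the indices `m` for which `A m \ L` is contained in `X` but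
      -- contains no generator of `X`: then `D K` generates a proper part of `X`
      obtain ⟨X, hXU, hXmin⟩ :=
        (wellFoundedLT_finGenInitialSegments (Q := Q)).wf.has_min _ hX
      have hXU : ∀ᶠ m in U, A m \ L ⊆ X := hXU
      obtain ⟨G, hG, hXG⟩ := X.2
      have hGU : ∀ᶠ m in U, ∀ t ∈ G, t ∉ A m \ L := by
        refine (eventually_all_finite hG).2 fun t _ => ?_
        by_cases ht : t ∈ L
        · exact Eventually.of_forall fun m h => h.2 ht
        · exact (hL t ht).mono fun m hm h => hm h.1
      refine ⟨{m | A m \ L ⊆ X ∧ ∀ t ∈ G, t ∉ A m \ L}, hXU.and hGU, fun K hK hKU => ?_⟩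
      have hDX : D K ⊆ X := by
        intro x hx
        simp only [D, mem_iUnion] at hx
        obtain ⟨k, hk, hxT, hxL⟩ := hx
        exact (hK k hk).1 ⟨(hmem k x).2 ⟨x, hxT, le_rfl⟩, hxL⟩
      have hGne : G.Nonempty := by
        obtain ⟨m, hm⟩ := hXU.exists
        obtain ⟨x, hx, hxL⟩ := hne m
        have := hm ⟨hx, hxL⟩
        rw [hXG] at this
        obtain ⟨t, ht, -⟩ := this
        exact ⟨t, ht⟩
      obtain ⟨t, ht⟩ := hG.exists_maximal hGne
      let Y : finGenInitialSegments Q := ⟨_, mem_finGenInitialSegments_of_finite (hD K)⟩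
      have hYX : Y ≤ X :=
        lowerClosure_min hDX (isLowerSet_of_mem_finGenInitialSegments X.2)
      have hXY : X ≤ Y := by
        by_contra hn
        exact hXmin Y hKU (lt_of_le_not_ge hYX hn)
      have htX : t ∈ X.1 := by
        rw [hXG]
        exact subset_lowerClosure ht.prop
      obtain ⟨d, hd, htd⟩ := hXY htX
      have hdX := hDX hd
      rw [hXG] at hdX
      obtain ⟨t', ht', hdt'⟩ := hdX
      have hdt : d = t := le_antisymm (hdt'.trans (ht.le_of_ge ht' (htd.trans hdt'))) htd
      simp only [D, mem_iUnion] at hd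
      obtain ⟨k, hk, hdT, hdL⟩ := hd
      exact (hK k hk).2 t ht.prop
        (hdt ▸ ⟨(hmem k d).2 ⟨d, hdT, le_rfl⟩, hdL⟩)
    · exact ⟨univ, univ_mem, fun K _ h =>
        hX ⟨⟨_, mem_finGenInitialSegments_of_finite (hD K)⟩, h⟩⟩
  classical
  -- greedy choice of pairs consisting of an index and a witness
  obtain ⟨f, hf, hfr⟩ := exists_seq_of_forall_finset_exists
    (fun p : ℕ × Q => p.1 ∈ S ∧ p.2 ∈ A p.1 ∧ p.2 ∉ L)
    (fun p q => p.2 ∉ A q.1 ∧ q.2 ∉ A p.1) (by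
      intro s hs
      have h1 : ∀ᶠ m in U, ∀ p ∈ s, p.2 ∉ A m :=
        (eventually_all_finset s).2 fun p hp => hL _ (hs p hp).2.2
      have h2 : ∀ᶠ m in U, ¬ A m \ L ⊆ lowerClosure (D (s.image Prod.fst)) :=
        Ultrafilter.eventually_not.2 (hS _ (by
          intro k hk
          obtain ⟨p, hp, rfl⟩ := Finset.mem_image.1 hk
          exact (hs p hp).1))
      have h3 : ∀ᶠ m in U, m ∈ S := hSU
      obtain ⟨m, hm1, hm2, hm3⟩ := (h1.and (h2.and h3)).exists
      obtain ⟨z, hz, hzD⟩ := not_subset.1 hm2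
      refine ⟨(m, z), ⟨hm3, hz.1, hz.2⟩, fun p hp => ⟨hm1 p hp, fun hzp => hzD ?_⟩⟩
      exact hDmem _ z hz.2 ⟨p.1, Finset.mem_image_of_mem _ hp, hzp⟩)
  refine ⟨fun n => (f n).1, fun n => (f n).2, fun m n => ⟨fun h => ?_, ?_⟩⟩
  · rcases lt_trichotomy m n with hmn | hmn | hmn
    · exact absurd h (hfr m n hmn).1
    · exact hmn
    · exact absurd h (hfr n m hmn).2
  · rintro rfl
    exact (hf m).2.1

/-- The embedding sends a finite set of indices to the union of the corresponding members of an
independent sequence. -/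
theorem exists_finset_embedding_of_infinite_antichain {𝓕 : Set (Set Q)}
    (h𝓕 : 𝓕 ⊆ finGenInitialSegments Q) {A : Set (Set Q)} (hA𝓕 : A ⊆ 𝓕) (hinf : A.Infinite)
    (hanti : IsAntichain (· ⊆ ·) A) : Nonempty (Finset ℕ ↪o finiteUnions 𝓕) := by
  let e := hinf.natEmbedding
  have he : ∀ m n, m ≠ n → ¬ (e m : Set Q) ⊆ e n := fun m n hmn =>
    hanti (e m).2 (e n).2 fun h => hmn (e.injective (Subtype.ext h))
  obtain ⟨φ, z, hz⟩ := exists_independent_subsequence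
    (A := fun n => (e n : Set Q)) (fun n => h𝓕 (hA𝓕 (e n).2)) he
  refine ⟨OrderEmbedding.ofMapLEIff (fun s => ⟨⋃₀ ((fun n => (e (φ n) : Set Q)) '' (s : Set ℕ)),
    _, ?_, s.finite_toSet.image _, rfl⟩) fun s t => ⟨fun h n hn => ?_, fun h => ?_⟩⟩
  · rintro _ ⟨n, -, rfl⟩
    exact hA𝓕 (e (φ n)).2
  · obtain ⟨_, ⟨m, hm, rfl⟩, hmz⟩ :=
      h (mem_sUnion.2 ⟨_, mem_image_of_mem _ (Finset.mem_coe.2 hn), (hz n n).2 rfl⟩)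
    rw [(hz n m).1 hmz]
    exact hm
  · exact sUnion_subset_sUnion (image_mono (Finset.coe_subset.2 h))

end Independent

/-! ### Well-foundedness from a well-quasi-ordered set of tests -/

/-- If the elements of `β` are separated by a well-quasi-ordered set of tests, each of them
inherited by larger elements of `β` and implied by larger tests, then `β` is well-founded: the
tests lost along a strictly decreasing sequence of `β` form a bad sequence. -/
theorem wellFoundedLT_of_separating {α β : Type*} [Preorder α] [WellQuasiOrderedLE α] [Preorder β]
    (R : α → β → Prop) (hα : ∀ {a a' b}, a ≤ a' → R a' b → R a b)
    (hβ : ∀ {a b b'}, R a b → b ≤ b' → R a b')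
    (hsep : ∀ {b b'}, b < b' → ∃ a, R a b' ∧ ¬ R a b) : WellFoundedLT β := by
  refine ⟨RelEmbedding.wellFounded_iff_isEmpty.2 ⟨fun f => ?_⟩⟩
  have hlt : ∀ {m n}, m < n → f n < f m := fun h => f.map_rel_iff.2 h
  choose a ha ha' using fun n => hsep (hlt (Nat.lt_succ_self n))
  obtain ⟨m, n, hmn, hle⟩ := wellQuasiOrdered_le a
  have hanti : f n ≤ f (m + 1) := by
    rcases (Nat.succ_le_of_lt hmn).eq_or_lt with h | h
    · exact h ▸ le_rfl
    · exact (hlt h).le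
  exact ha' m (hβ (hα hle (ha n)) hanti)

/-! ### Finite and arbitrary unions of a well-quasi-ordered family -/

section Unions

variable {E : Type*} {𝓕 : Set (Set E)}

theorem wellQuasiOrderedLE_of_no_infinite_antichain [WellFoundedLT 𝓕]
    (h : ¬ ∃ A : Set (Set E), A ⊆ 𝓕 ∧ A.Infinite ∧ IsAntichain (· ⊆ ·) A) :
    WellQuasiOrderedLE 𝓕 := by
  refine wellQuasiOrderedLE_iff.2 ⟨inferInstance, fun s hs => ?_⟩
  by_contra hinf
  refine h ⟨Subtype.val '' s, ?_, Set.Infinite.image Subtype.val_injective.injOn hinf, ?_⟩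
  · rintro _ ⟨x, -, rfl⟩
    exact x.2
  · rintro _ ⟨x, hx, rfl⟩ _ ⟨y, hy, rfl⟩ hxy hle
    exact hs hx hy (fun h => hxy (congrArg _ h)) hle

/-- By Higman's lemma, finite unions of members of a well-quasi-ordered family are
well-quasi-ordered. -/
theorem wellQuasiOrderedLE_finiteUnions [WellQuasiOrderedLE 𝓕] :
    WellQuasiOrderedLE (finiteUnions 𝓕) := by
  have hig := (isPWO_univ_iff.2 ‹WellQuasiOrderedLE 𝓕›).partiallyWellOrderedOn_sublistForall₂
  refine ⟨fun f => ?_⟩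
  choose S hS hfin hf using fun n => (f n).2
  choose l hl using fun n => (hfin n).preimage (Subtype.val_injective (p := (· ∈ 𝓕))).injOn
    |>.exists_finset_coe
  obtain ⟨m, n, hmn, hsub⟩ := hig.exists_lt (f := fun n => (l n).toList) fun n _ _ => mem_univ _
  refine ⟨m, n, hmn, ?_⟩
  change (f m).1 ⊆ (f n).1
  rw [hf m, hf n]
  rintro x ⟨X, hX, hx⟩
  obtain ⟨k, hk, hkl⟩ := List.sublistForall₂_iff.1 hsub
  have hXl : (⟨X, hS m hX⟩ : 𝓕) ∈ (l m).toList := by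
    rw [Finset.mem_toList, ← Finset.mem_coe, hl]
    exact hX
  obtain ⟨Y, hY, hXY⟩ : ∃ Y ∈ k, (⟨X, hS m hX⟩ : 𝓕) ≤ Y := by
    generalize (l m).toList = l' at hXl hk
    clear hkl hsub
    induction hk with
    | nil => simp at hXl
    | cons h _ ih =>
      rcases List.mem_cons.1 hXl with h' | h'
      · exact ⟨_, List.mem_cons_self, h' ▸ h⟩
      · obtain ⟨Y, hY, h⟩ := ih h'
        exact ⟨Y, List.mem_cons_of_mem _ hY, h⟩
  have hYS : Y ∈ (l n : Set 𝓕) := Finset.mem_toList.1 (hkl.subset hY)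
  rw [hl] at hYS
  exact ⟨Y, hYS, hXY hx⟩

theorem wellFoundedLT_arbitraryUnions [WellQuasiOrderedLE 𝓕] :
    WellFoundedLT (arbitraryUnions 𝓕) := by
  refine wellFoundedLT_of_separating (fun (X : 𝓕) (Y : arbitraryUnions 𝓕) => X.1 ⊆ Y.1)
    (fun hX h => Subset.trans hX h) (fun h hY => Subset.trans h hY) fun {Y Z} hYZ => ?_
  obtain ⟨S, hS, hZ⟩ := Z.2
  by_contra! h
  refine hYZ.not_ge ?_
  change Z.1 ⊆ Y.1
  rw [hZ]
  exact sUnion_subset fun X hX => h ⟨X, hS hX⟩ (hZ ▸ subset_sUnion_of_mem hX)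

/-- The rationals embed in their own power set as Dedekind cuts, hence in that of `ℕ` by
enumeration. -/
theorem nonempty_rat_orderEmbedding_set_nat : Nonempty (ℚ ↪o Set ℕ) := by
  refine ⟨OrderEmbedding.ofMapLEIff (fun q => Encodable.encode '' Iic q) fun p q => ?_⟩
  exact (image_subset_image_iff Encodable.encode_injective).trans Iic_subset_Iic

end Unions

section FinGenUnions

variable {Q : Type*} [PartialOrder Q] {𝓕 : Set (Set Q)}

/-- An embedding of the finite subsets of `ℕ` in the finite unions extends to one of the power set
of `ℕ` in the arbitrary unions, by compactness of finitely generated initial segments. -/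
theorem nonempty_set_embedding_of_finset_embedding (h𝓕 : 𝓕 ⊆ finGenInitialSegments Q)
    (f : Finset ℕ ↪o finiteUnions 𝓕) : Nonempty (Set ℕ ↪o arbitraryUnions 𝓕) := by
  classical
  have hfg : ∀ s, (f s : Set Q) ∈ finGenInitialSegments Q := fun s =>
    finiteUnions_subset_finGenInitialSegments h𝓕 (f s).2
  choose S hS hfin hf using fun s => (f s).2
  refine ⟨OrderEmbedding.ofMapLEIff
    (fun s => ⟨⋃ a : {a : Finset ℕ // (a : Set ℕ) ⊆ s}, (f a : Set Q),
      ⋃ a : {a : Finset ℕ // (a : Set ℕ) ⊆ s}, S a, iUnion_subset fun a => hS a, ?_⟩)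
    fun s t => ⟨fun h n hn => ?_, fun h => ?_⟩⟩
  · rw [sUnion_iUnion]
    exact iUnion_congr fun a => hf a
  · have : Nonempty {a : Finset ℕ // (a : Set ℕ) ⊆ t} := ⟨⟨∅, by simp⟩⟩
    have hn' : (({n} : Finset ℕ) : Set ℕ) ⊆ s := by simpa using hn
    obtain ⟨⟨b, hb⟩, hnb⟩ := exists_subset_of_subset_iUnion_of_directed (hfg {n})
      (F := fun a : {a : Finset ℕ // (a : Set ℕ) ⊆ t} => (f a : Set Q))
      (fun a => isLowerSet_of_mem_finGenInitialSegments (hfg a))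
      (fun a b => ⟨⟨a.1 ∪ b.1, by simp [a.2, b.2]⟩,
        f.monotone Finset.subset_union_left, f.monotone Finset.subset_union_right⟩)
      ((subset_iUnion (fun a : {a : Finset ℕ // (a : Set ℕ) ⊆ s} => (f a : Set Q))
        ⟨{n}, hn'⟩).trans h)
    exact hb (Finset.singleton_subset_iff.1 (f.le_iff_le.1 hnb))
  · exact iUnion_subset fun a => subset_iUnion
      (fun a : {a : Finset ℕ // (a : Set ℕ) ⊆ t} => (f a : Set Q)) ⟨a.1, a.2.trans h⟩

end FinGenUnions

/-! ### Scatteredness of the space of ideals -/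

section Ideals

variable {P : Type*} [PartialOrder P]

theorem isClopen_setOf_mem_ideal (p : P) : IsClopen {J : Order.Ideal P | p ∈ J} := by
  classical
  have hc : Continuous fun J : Order.Ideal P => decide (p ∈ J) := by
    have h : Continuous fun (J : Order.Ideal P) (x : P) => decide (x ∈ J) := by
      convert continuous_induced_dom (f := fun (J : Order.Ideal P) (x : P) =>
        @decide (x ∈ J) (Classical.propDecidable _)) using 3
    exact (continuous_apply p).comp h
  have h := (isClopen_discrete ({true} : Set Bool)).preimage hc
  simpa [preimage] using h

/-- The complement of an ideal of a well-quasi-ordered poset is generated by finitely many elements,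
so an inclusion-minimal member of `C` is isolated in `C`. -/
theorem topologicallyScattered_ideal [WellQuasiOrderedLE P] :
    TopologicallyScattered (Order.Ideal P) := by
  intro C _ hC
  have hwf : WellFoundedLT (Order.Ideal P) :=
    wellFoundedLT_of_separating (fun (p : P) (J : Order.Ideal P) => p ∈ J)
      (fun {_ _ J} hp h => J.lower hp h) (fun h hJ => hJ h) fun h => SetLike.exists_of_lt h
        |>.imp fun _ => id
  obtain ⟨J, hJ, hmin⟩ := hwf.wf.has_min C hC
  let M : Set P := {p | Minimal (· ∉ J) p}
  have hM : M.Finite := WellQuasiOrderedLE.finite_of_isAntichain (setOfPred_minimal_antichain _)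
  refine ⟨J, hJ, ⋂ p ∈ M, {K | p ∈ K}ᶜ,
    hM.isOpen_biInter fun p _ => (isClopen_setOf_mem_ideal p).compl.isOpen,
    Subset.antisymm ?_ (singleton_subset_iff.2
      ⟨mem_iInter₂.2 fun p hp => Minimal.prop (P := (· ∉ J)) hp, hJ⟩)⟩
  rintro K ⟨hK, hKC⟩
  have hKJ : K ≤ J := by
    intro p hp
    by_contra hpJ
    obtain ⟨q, hqp, hq⟩ := exists_minimal_le_of_wellFoundedLT (· ∉ J) p hpJ
    exact mem_iInter₂.1 hK q hq (K.lower hqp hp)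
  by_contra hne
  exact hmin K hKC (lt_of_le_of_ne hKJ hne)

/-- A neighbourhood of an ideal is determined by finitely many membership and non-membership
conditions. -/
theorem exists_finset_of_isOpen_ideal {U : Set (Order.Ideal P)} (hU : IsOpen U)
    {J : Order.Ideal P} (hJ : J ∈ U) :
    ∃ s : Finset P, ∀ K : Order.Ideal P, (∀ p ∈ s, p ∈ K ↔ p ∈ J) → K ∈ U := by
  classical
  obtain ⟨V, hV, rfl⟩ := isOpen_induced_iff.1 hU
  obtain ⟨s, u, hu, hsu⟩ := isOpen_pi_iff.1 hV _ hJ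
  refine ⟨s, fun K hK => hsu fun p hp => ?_⟩
  have := (hu p hp).2
  convert this using 1
  simp [hK p hp]

/-- The ideal generated by the images of the finite subsets of `S`. -/
def idealOfSet (f : Finset ℕ →o P) (S : Set ℕ) : Order.Ideal P where
  carrier := {p | ∃ a : Finset ℕ, (a : Set ℕ) ⊆ S ∧ p ≤ f a}
  lower' := by
    rintro p q hqp ⟨a, ha, hpa⟩
    exact ⟨a, ha, le_trans hqp hpa⟩
  nonempty' := ⟨f ∅, ∅, by simp, le_rfl⟩
  directed' := by
    classical
    rintro p ⟨a, ha, hpa⟩ q ⟨b, hb, hqb⟩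
    exact ⟨f (a ∪ b), ⟨a ∪ b, by simp [ha, hb], le_rfl⟩,
      hpa.trans (f.monotone Finset.subset_union_left),
      hqb.trans (f.monotone Finset.subset_union_right)⟩

theorem mem_idealOfSet {f : Finset ℕ →o P} {S : Set ℕ} {p : P} :
    p ∈ idealOfSet f S ↔ ∃ a : Finset ℕ, (a : Set ℕ) ⊆ S ∧ p ≤ f a :=
  Iff.rfl

/-- If the finite subsets of `ℕ` embed in `P`, then the ideals attached to the infinite subsets
of `ℕ` are dense in themselves: removing from `S` a number far away changes the ideal of `S`, but
not its trace on a given finite set. -/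
theorem isEmpty_finset_embedding_of_topologicallyScattered
    (h : TopologicallyScattered (Order.Ideal P)) : IsEmpty (Finset ℕ ↪o P) := by
  classical
  refine ⟨fun f => ?_⟩
  let g : Finset ℕ →o P := f.toOrderHom
  let D : Set (Order.Ideal P) := idealOfSet g '' {S | S.Infinite}
  have hD : D.Nonempty := ⟨_, univ, infinite_univ, rfl⟩
  obtain ⟨J, hJ, U, hU, hUJ⟩ := h (closure D) isClosed_closure hD.closure
  have hJU : J ∈ U := (hUJ.symm.subset rfl).1
  obtain ⟨J', hJ'U, hJ'D⟩ := mem_closure_iff.1 hJ U hU hJU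
  obtain rfl : J' = J := hUJ.subset ⟨hJ'U, subset_closure hJ'D⟩
  obtain ⟨S, hS, rfl⟩ := hJ'D
  obtain ⟨s, hs⟩ := exists_finset_of_isOpen_ideal hU hJU
  have hex : ∀ p, ∃ a : Finset ℕ, (a : Set ℕ) ⊆ S ∧ (p ∈ idealOfSet g S → p ≤ g a) := by
    intro p
    by_cases hp : p ∈ idealOfSet g S
    · obtain ⟨a, ha, hpa⟩ := hp
      exact ⟨a, ha, fun _ => hpa⟩
    · exact ⟨∅, by simp, fun h => absurd h hp⟩
  choose a haS ha using hex
  obtain ⟨n, hnS, hn⟩ := hS.exists_notMem_finset (s.biUnion a)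
  have hmem : idealOfSet g (S \ {n}) ∈ U := by
    refine hs _ fun p hp => ⟨?_, fun hpS => ⟨a p, fun k hk => ⟨haS p hk, ?_⟩, ha p hpS⟩⟩
    · rintro ⟨b, hb, hpb⟩
      exact ⟨b, hb.trans sdiff_subset, hpb⟩
    · rintro rfl
      exact hn (Finset.mem_biUnion.2 ⟨p, hp, hk⟩)
  have heq : idealOfSet g (S \ {n}) = idealOfSet g S :=
    hUJ.subset ⟨hmem, subset_closure ⟨_, hS.sdiff (finite_singleton n), rfl⟩⟩
  have hgn : g {n} ∈ idealOfSet g S := ⟨{n}, by simpa using hnS, le_rfl⟩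
  rw [← heq] at hgn
  obtain ⟨b, hb, hnb⟩ := hgn
  exact (hb (Finset.singleton_subset_iff.1 (f.le_iff_le.1 hnb))).2 rfl

end Ideals

/-! ### The equivalences -/

theorem theorem4p13 {Q : Type*} [PartialOrder Q] [WellFoundedLT Q]
    (𝓕 : Set (Set Q)) (h𝓕 : 𝓕 ⊆ finGenInitialSegments Q) :
    List.TFAE [
      ¬ ∃ A : Set (Set Q), A ⊆ 𝓕 ∧ A.Infinite ∧ IsAntichain (· ⊆ ·) A,
      WellQuasiOrderedLE (finiteUnions 𝓕),
      TopologicallyScattered (Order.Ideal (finiteUnions 𝓕)),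
      OrderScattered (arbitraryUnions 𝓕),
      IsEmpty (Set ℕ ↪o arbitraryUnions 𝓕),
      IsEmpty (Finset ℕ ↪o finiteUnions 𝓕),
      WellFoundedLT (arbitraryUnions 𝓕)] := by
  have hwf : WellFoundedLT 𝓕 :=
    ⟨InvImage.wf (inclusion h𝓕) (wellFoundedLT_finGenInitialSegments (Q := Q)).wf⟩
  tfae_have 1 → 2 := fun h =>
    have := wellQuasiOrderedLE_of_no_infinite_antichain h
    wellQuasiOrderedLE_finiteUnions
  tfae_have 2 → 3 := fun _ => topologicallyScattered_ideal
  tfae_have 3 → 6 := isEmpty_finset_embedding_of_topologicallyScattered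
  tfae_have 6 → 1 := by
    rintro h ⟨A, hA, hinf, hanti⟩
    exact not_isEmpty_iff.2 (exists_finset_embedding_of_infinite_antichain h𝓕 hA hinf hanti) h
  tfae_have 1 → 7 := fun h =>
    have := wellQuasiOrderedLE_of_no_infinite_antichain h
    wellFoundedLT_arbitraryUnions
  tfae_have 7 → 4 := fun h => ⟨fun f => not_strictAnti_of_wellFoundedLT (fun n : ℕ => f (-n))
    fun m n hmn => f.lt_iff_lt.2 (neg_lt_neg (Nat.cast_lt.2 hmn))⟩
  tfae_have 4 → 5 := by
    rintro ⟨h⟩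
    obtain ⟨e⟩ := nonempty_rat_orderEmbedding_set_nat
    exact ⟨fun f => h (e.trans f)⟩
  tfae_have 5 → 6 := by
    rintro h
    exact ⟨fun f => not_isEmpty_iff.2 (nonempty_set_embedding_of_finset_embedding h𝓕 f) h⟩
  tfae_finish
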